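/- Conventions. Let $1\le n\le\omega$. For Boolean algebras write $\cdot,\prod$ for meets, and $\langle X\rangle$ for the subalgebra generated by $X$. If $A,B$ are nontrivial Boolean algebras and $U\subseteq A$, a function $f:U\to B$ is \emph{$n$-preserving} (for $n<\omega$) if for all $a_0,\dots,a_{n-1}\in U$, $\prod_{i<n}a_i=0$ implies $\prod_{i<n}f(a_i)=0$; it is \emph{$\omega$-preserving} if for every finite $S\subseteq U$, $\prod S=0$ implies $\prod f[S]=0$. A nontrivial Boolean algebra $A$ is \emph{$n$-free over} $X\subseteq A$ if every $n$-preserving function from $X$ into an arbitrary nontrivial Boolean algebra $B$ extends to a unique homomorphism $A\to B$; it is \emph{$n$-free} if it is $n$-free over some subset. If $C\le A_i\le A$ for $i\in I$, then $A$ is the \emph{amalgamated free product} of the $A_i$ over $C$ if for every Boolean algebra $B$ and all homomorphisms $f_i:A_i\to B$ with $f_i\restriction C=f_j\restriction C$ for all $i,j\in I$ there is a unique homomorphism $A\to B$ extending all $f_i$. The \emph{free product} of Boolean algebras $A_i$ is their coproduct $(F,(e_i:A_i\to F)_{i\in I})$. For a (simple) graph $\mathscr G$ with vertex set $V$, the clique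 space of $\mathscr G$ is the subspace of $2^V$ of all characteristic functions of complete subgraphs of $\mathscr G$; a \emph{graph space} is a topological space homeomorphic to the clique space of some graph. Theorem. (1) Let $A$ be a Boolean algebra with subalgebras $C\le A_i\le A$ $(i\in I)$ such that $A$ is the amalgamated free product of the $A_i$ over $C$. Suppose that $A_i\cap A_j=C$ for $i\ne j$, that each $A_i$ is $n$-free over $H_i\subseteq A_i$, and that $C\le\langle H_i\cap H_j\rangle$ for $i\neq j$. Then $A$ is $n$-free over $\bigcup_{i\in I}H_i$. (2) In particular, if $F$ with $e_i:A_i\to F$ is the free product of Boolean algebras $A_i$ $(i\in I)$ and each $A_i$ is $n$-free over $H_i$, then $F$ is $n$-free over $\bigcup_{i\in I}e_i[H_i]$; hence every free product of $n$-free Boolean algebras is $n$-free. (3) Dually, an arbitrary (topological) product of graph spaces is a graph space. -/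

import Mathlib

universe u v w t

/-- For `1 ≤ n < ω`, a function `f` defined on a subset `U` of a Boolean algebra is `n`-preserving
if `a₀ · … · aₙ₋₁ = 0` implies `f a₀ · … · f aₙ₋₁ = 0` for all `a₀, …, aₙ₋₁ ∈ U` (repetitions
allowed); it is `ω`-preserving if `∏ S = 0` implies `∏ f[S] = 0` for every finite `S ⊆ U`.
Here `ω` is represented by `⊤ : ℕ∞`. -/
def IsPreserving {A : Type u} [BooleanAlgebra A] {B : Type w} [BooleanAlgebra B]
    (n : ℕ∞) {U : Set A} (f : U → B) : Prop :=
  (∀ k : ℕ, n = (k : ℕ∞) → ∀ a : Fin k → U,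
    Finset.univ.inf (fun i => (a i : A)) = ⊥ → Finset.univ.inf (fun i => f (a i)) = ⊥) ∧
  (n = ⊤ → ∀ S : Finset U, S.inf (fun x => (x : A)) = ⊥ → S.inf f = ⊥)

/-- A nontrivial Boolean algebra `A` is `n`-free over its subset `X` if every `n`-preserving
function from `X` to a nontrivial Boolean algebra `B` extends to a unique homomorphism `A → B`. -/
structure IsNFreeOver (A : Type u) [BooleanAlgebra A] (n : ℕ∞) (X : Set A) : Prop where
  nontrivial : Nontrivial A
  existsUnique_extension : ∀ (B : Type w) [BooleanAlgebra B] [Nontrivial B] (f : X → B),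
    IsPreserving n f → ∃! φ : BoundedLatticeHom A B, ∀ x : X, φ (x : A) = f x

/-- A Boolean algebra is `n`-free if it is `n`-free over some subset. -/
def IsNFree (A : Type u) [BooleanAlgebra A] (n : ℕ∞) : Prop :=
  ∃ X : Set A, IsNFreeOver.{u, w} A n X

/-- The Boolean algebra `A` is the amalgamated free product over its subalgebra `C` of its
subalgebras `S i`, each of which contains `C`: every family of homomorphisms `S i → B` which agree
on `C` has a unique common extension to a homomorphism `A → B`. -/
structure IsAmalgamatedFreeProduct {A : Type u} [BooleanAlgebra A] {I : Type v}
    (C : BooleanSubalgebra A) (S : I → BooleanSubalgebra A) : Prop where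
  le : ∀ i, C ≤ S i
  existsUnique_lift : ∀ (B : Type w) [BooleanAlgebra B] (f : ∀ i, BoundedLatticeHom (S i) B),
    (∀ i j, ∀ c : C,
      f i (BooleanSubalgebra.inclusion (le i) c) = f j (BooleanSubalgebra.inclusion (le j) c)) →
    ∃! φ : BoundedLatticeHom A B, ∀ i, ∀ a : S i, φ (a : A) = f i a

/-- `F`, with the homomorphisms `e i : A i → F`, is the free product (the coproduct) of the
Boolean algebras `A i`. -/
def IsFreeProduct {I : Type v} {A : I → Type u} [∀ i, BooleanAlgebra (A i)]
    {F : Type t} [BooleanAlgebra F] (e : ∀ i, BoundedLatticeHom (A i) F) : Prop :=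
  ∀ (B : Type w) [BooleanAlgebra B] (f : ∀ i, BoundedLatticeHom (A i) B),
    ∃! φ : BoundedLatticeHom F B, ∀ i, ∀ a : A i, φ (e i a) = f i a

/-- The set of (characteristic functions of) complete subgraphs of `G`. Its subspace topology
inherited from `2 ^ V` has the sets `{f | f v = 1}` and `{f | f v = 0}`, `v ∈ V`, as a subbase. -/
def cliqueSpace {V : Type u} (G : SimpleGraph V) : Set (V → Bool) :=
  {f | G.IsClique {v | f v = true}}

/-- A graph space is a topological space homeomorphic to the clique space of some graph.
(The vertices of `G` embed into the clique space as singletons, so that a graph with vertices in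
the universe of `X` can always be taken.) -/
def IsGraphSpace (X : Type u) [TopologicalSpace X] : Prop :=
  ∃ (V : Type u) (G : SimpleGraph V), Nonempty (X ≃ₜ cliqueSpace G)

/-! An `n`-preserving `f` on the union of the generating sets restricts along each factor's
homomorphism to an `n`-preserving function on `H i`, since homomorphisms keep vanishing meets
(`IsPreserving.comp_hom`); `n`-freeness of the factor extends it to a unique `g i`. In the
amalgamated case `g i` and `g j` both equal `f` on the common generators, hence agree on the
subalgebra these generate, which contains `C` (`eq_of_mem_closure`), so the universal property glues
them. In a free product no agreement is needed.

For graph spaces, take the disjoint union of the graphs with all edges between different ones: a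
vertex set is a clique iff its trace on each graph is, so the clique space is the product. -/

/-- Preservation pulls back along a homomorphism. -/
theorem IsPreserving.comp_hom {A A' B : Type*} [BooleanAlgebra A] [BooleanAlgebra A']
    [BooleanAlgebra B] {n : ℕ∞} {U : Set A} {V : Set A'} (g : BoundedLatticeHom A A')
    (h : ∀ x : U, g x ∈ V) {f : V → B} (hf : IsPreserving n f) :
    IsPreserving n fun x : U => f ⟨g x, h x⟩ := by
  classical
  refine ⟨fun k hk a ha => hf.1 k hk (fun i => ⟨g (a i), h (a i)⟩) ?_, fun hn T hT => ?_⟩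
  · simpa [map_finset_inf, Function.comp_def] using congrArg g ha
  · have := hf.2 hn (T.image fun x : U => ⟨g x, h x⟩) ?_
    · simpa [Finset.inf_image, Function.comp_def] using this
    · simpa [Finset.inf_image, map_finset_inf, Function.comp_def] using congrArg g hT

theorem BoundedLatticeHom.domain_nontrivial {A B : Type*} [Lattice A] [BoundedOrder A]
    [Lattice B] [BoundedOrder B] [Nontrivial B] (φ : BoundedLatticeHom A B) : Nontrivial A := by
  refine ⟨⊥, ⊤, fun h => bot_ne_top (α := B) ?_⟩
  rw [← map_bot φ, h, map_top]

/-- The homomorphism onto the two-element algebra given by a prime ideal. -/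
def Order.Ideal.IsPrime.toHom {A : Type u} [BooleanAlgebra A] {J : Order.Ideal A}
    (hJ : J.IsPrime) : BoundedLatticeHom A (Set PUnit.{w + 1}) where
  toFun a := {_x | a ∉ J}
  map_sup' a b := by
    ext
    simp only [Set.mem_ofPred_eq, Set.sup_eq_union, Set.mem_union, Order.Ideal.sup_mem_iff]
    tauto
  map_inf' a b := by
    ext
    have h : a ⊓ b ∈ J ↔ a ∈ J ∨ b ∈ J :=
      ⟨hJ.mem_or_mem, fun h => h.elim (J.lower inf_le_left) (J.lower inf_le_right)⟩
    simp [h]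
  map_top' := by
    ext
    simpa using hJ.top_notMem
  map_bot' := by
    ext
    simp

/-- A prime ideal supplies the map. `Set PUnit` is the two-element algebra placed in the universe
over which the universal properties range. -/
theorem exists_hom_set_punit (A : Type u) [BooleanAlgebra A] [Nontrivial A] :
    Nonempty (BoundedLatticeHom A (Set PUnit.{w + 1})) := by
  obtain ⟨J, hJ, -⟩ := DistribLattice.prime_ideal_of_disjoint_filter_ideal
    (F := Order.PFilter.principal (⊤ : A)) (I := Order.Ideal.principal (⊥ : A)) (by
      rw [Set.disjoint_left]
      intro a ha hb
      have h₁ : ⊤ ≤ a := Order.PFilter.mem_principal.1 ha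
      have h₂ : a ≤ ⊥ := Order.Ideal.mem_principal.1 hb
      exact bot_ne_top (top_le_iff.1 (h₁.trans h₂)))
  exact ⟨hJ.toHom⟩

/-- Homomorphisms on two subalgebras which agree on a subset of both agree on the subalgebra
generated by it. -/
theorem eq_of_mem_closure {A B : Type*} [BooleanAlgebra A] [BooleanAlgebra B]
    {S T : BooleanSubalgebra A} (f : BoundedLatticeHom S B) (g : BoundedLatticeHom T B)
    {s : Set A} (hs : ∀ a ∈ s, ∃ (h₁ : a ∈ S) (h₂ : a ∈ T), f ⟨a, h₁⟩ = g ⟨a, h₂⟩)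
    {a : A} (ha : a ∈ BooleanSubalgebra.closure s) :
    ∃ (h₁ : a ∈ S) (h₂ : a ∈ T), f ⟨a, h₁⟩ = g ⟨a, h₂⟩ := by
  induction ha using BooleanSubalgebra.closure_bot_sup_induction with
  | mem x hx => exact hs x hx
  | bot => exact ⟨S.bot_mem, T.bot_mem, by simp⟩
  | sup x _ y _ hx hy =>
    obtain ⟨x₁, x₂, hx⟩ := hx
    obtain ⟨y₁, y₂, hy⟩ := hy
    refine ⟨S.sup_mem x₁ y₁, T.sup_mem x₂ y₂, ?_⟩
    rw [← BooleanSubalgebra.mk_sup_mk _ _ x₁ y₁, ← BooleanSubalgebra.mk_sup_mk _ _ x₂ y₂,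
      map_sup, map_sup, hx, hy]
  | compl x _ hx =>
    obtain ⟨x₁, x₂, hx⟩ := hx
    refine ⟨S.compl_mem x₁, T.compl_mem x₂, ?_⟩
    rw [← BooleanSubalgebra.compl_mk _ x₁, ← BooleanSubalgebra.compl_mk _ x₂,
      map_compl', map_compl', hx]

theorem IsAmalgamatedFreeProduct.isNFreeOver {n : ℕ∞} {A : Type u} [BooleanAlgebra A]
    {I : Type v} {C : BooleanSubalgebra A} {S : I → BooleanSubalgebra A} {H : ∀ i, Set (S i)}
    (hA : IsAmalgamatedFreeProduct.{u, v, w} C S)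
    (hS : ∀ i, IsNFreeOver.{u, w} (S i) n (H i))
    (hC : ∀ i j, i ≠ j → C ≤ BooleanSubalgebra.closure
      (((fun a : S i => (a : A)) '' H i) ∩ ((fun a : S j => (a : A)) '' H j))) :
    IsNFreeOver.{u, w} A n (⋃ i, (fun a : S i => (a : A)) '' H i) where
  nontrivial := by
    -- With no factors, the empty family still lifts to a homomorphism into a nontrivial algebra;
    -- otherwise `A` contains a nontrivial subalgebra.
    rcases isEmpty_or_nonempty I with hI | ⟨⟨i⟩⟩
    · obtain ⟨φ, -⟩ := hA.existsUnique_lift (Set PUnit.{w + 1}) (fun i => isEmptyElim i)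
        fun i => isEmptyElim i
      exact φ.domain_nontrivial
    · have := (hS i).nontrivial
      exact (Subtype.val_injective (p := (· ∈ S i))).nontrivial
  existsUnique_extension B _ _ f hf := by
    have hmem : ∀ i (x : H i), (S i).subtype x ∈ ⋃ i, (fun a : S i => (a : A)) '' H i :=
      fun i x => Set.mem_iUnion.2 ⟨i, x, x.2, rfl⟩
    choose g hg hg' using fun i =>
      (hS i).existsUnique_extension B _ (hf.comp_hom (S i).subtype (hmem i))
    obtain ⟨φ, hφ, hφ'⟩ := hA.existsUnique_lift B g (by
      intro i j c
      rcases eq_or_ne i j with rfl | hij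
      · rfl
      obtain ⟨_, _, h⟩ := eq_of_mem_closure (g i) (g j) (by
        rintro _ ⟨⟨x, hx, rfl⟩, ⟨y, hy, hxy⟩⟩
        change (y : A) = x at hxy
        have hxj : (x : A) ∈ S j := hxy ▸ y.2
        refine ⟨x.2, hxj, ?_⟩
        rw [show (⟨x, hxj⟩ : S j) = y from Subtype.ext hxy.symm]
        refine (hg i ⟨x, hx⟩).trans (Eq.trans ?_ (hg j ⟨y, hy⟩).symm)
        exact congrArg f (Subtype.ext hxy.symm)) (hC i j hij c.2)
      exact h)
    refine ⟨φ, ?_, fun ψ hψ => hφ' ψ fun i a => ?_⟩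
    · rintro ⟨x, hx⟩
      obtain ⟨i, y, hy, rfl⟩ := Set.mem_iUnion.1 hx
      exact (hφ i y).trans (hg i ⟨y, hy⟩)
    -- The restriction of `ψ` to `S i` extends `f` on `H i`, so it is `g i`.
    · exact DFunLike.congr_fun
        (hg' i (ψ.comp (S i).subtype) fun x => hψ ⟨(S i).subtype x, hmem i x⟩) a

theorem IsFreeProduct.isNFreeOver {n : ℕ∞} {I : Type v} {A : I → Type u}
    [∀ i, BooleanAlgebra (A i)] {F : Type t} [BooleanAlgebra F]
    {e : ∀ i, BoundedLatticeHom (A i) F} (he : IsFreeProduct.{u, v, w, t} e)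
    {H : ∀ i, Set (A i)} (hA : ∀ i, IsNFreeOver.{u, w} (A i) n (H i)) :
    IsNFreeOver.{t, w} F n (⋃ i, e i '' H i) where
  nontrivial := by
    -- The `e i` are not known to be injective, so nontriviality of `F` comes from lifting
    -- homomorphisms of all factors into one two-element algebra.
    have h i : Nonempty (BoundedLatticeHom (A i) (Set PUnit.{w + 1})) :=
      have := (hA i).nontrivial
      exists_hom_set_punit (A i)
    obtain ⟨φ, -⟩ := he _ fun i => (h i).some
    exact φ.domain_nontrivial
  existsUnique_extension B _ _ f hf := by
    have hmem : ∀ i (x : H i), e i x ∈ ⋃ i, e i '' H i :=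
      fun i x => Set.mem_iUnion.2 ⟨i, x, x.2, rfl⟩
    choose g hg hg' using fun i =>
      (hA i).existsUnique_extension B _ (hf.comp_hom (e i) (hmem i))
    obtain ⟨φ, hφ, hφ'⟩ := he B g
    refine ⟨φ, ?_, fun ψ hψ => hφ' ψ fun i a => ?_⟩
    · rintro ⟨x, hx⟩
      obtain ⟨i, y, hy, rfl⟩ := Set.mem_iUnion.1 hx
      exact (hφ i y).trans (hg i ⟨y, hy⟩)
    · exact DFunLike.congr_fun
        (hg' i (ψ.comp (e i)) fun x => hψ ⟨e i x, hmem i x⟩) a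

/-- The join of a family of graphs: their disjoint union, with all edges between vertices of
different graphs added. -/
def SimpleGraph.sigmaJoin {I : Type v} {V : I → Type u} (G : ∀ i, SimpleGraph (V i)) :
    SimpleGraph (Σ i, V i) where
  -- The implication is vacuous for different indices; the equations avoid a transport between
  -- fibres.
  Adj x y := x ≠ y ∧ ∀ i a b, x = ⟨i, a⟩ → y = ⟨i, b⟩ → (G i).Adj a b
  symm := ⟨fun _ _ h => ⟨h.1.symm, fun i a b hx hy => (h.2 i b a hy hx).symm⟩⟩
  loopless := ⟨fun _ h => h.1 rfl⟩

theorem SimpleGraph.mem_cliqueSpace_sigmaJoin {I : Type v} {V : I → Type u}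
    {G : ∀ i, SimpleGraph (V i)} {f : (Σ i, V i) → Bool} :
    f ∈ cliqueSpace (SimpleGraph.sigmaJoin G) ↔
      ∀ i, (fun a => f ⟨i, a⟩) ∈ cliqueSpace (G i) := by
  constructor
  · intro h i a ha b hb hab
    exact (h (x := ⟨i, a⟩) ha (y := ⟨i, b⟩) hb (by simpa using hab)).2 i a b rfl rfl
  · intro h x hx y hy hxy
    refine ⟨hxy, ?_⟩
    rintro i a b rfl rfl
    exact h i hx hy (by simpa using hxy)

/-- The clique space of a join is the product of the clique spaces. -/
def SimpleGraph.piCliqueSpaceHomeomorph {I : Type v} {V : I → Type u}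
    (G : ∀ i, SimpleGraph (V i)) :
    (∀ i, cliqueSpace (G i)) ≃ₜ cliqueSpace (SimpleGraph.sigmaJoin G) where
  toFun f := ⟨fun x => (f x.1).1 x.2,
    SimpleGraph.mem_cliqueSpace_sigmaJoin.2 fun i => (f i).2⟩
  invFun f i := ⟨fun a => f.1 ⟨i, a⟩, SimpleGraph.mem_cliqueSpace_sigmaJoin.1 f.2 i⟩
  left_inv _ := rfl
  right_inv _ := rfl
  continuous_toFun := Continuous.subtype_mk (continuous_pi fun x =>
    (continuous_apply x.2).comp (continuous_subtype_val.comp (continuous_apply x.1))) _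
  continuous_invFun := continuous_pi fun i => by
    refine Continuous.subtype_mk (continuous_pi fun a => ?_) _
    exact (continuous_apply (⟨i, a⟩ : Σ i, V i)).comp continuous_subtype_val

theorem mainTheorem5 :
    -- amalgamated free products
    (∀ (n : ℕ∞), 1 ≤ n → ∀ (A : Type u) [BooleanAlgebra A] (I : Type v)
      (C : BooleanSubalgebra A) (S : I → BooleanSubalgebra A) (H : ∀ i, Set (S i)),
      IsAmalgamatedFreeProduct.{u, v, w} C S →
      (∀ i j, i ≠ j → S i ⊓ S j = C) →
      (∀ i, IsNFreeOver.{u, w} (S i) n (H i)) →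
      (∀ i j, i ≠ j →
        C ≤ BooleanSubalgebra.closure
          (((fun a : S i => (a : A)) '' H i) ∩ ((fun a : S j => (a : A)) '' H j))) →
      IsNFreeOver.{u, w} A n (⋃ i, (fun a : S i => (a : A)) '' H i)) ∧
    -- free products
    (∀ (n : ℕ∞), 1 ≤ n → ∀ (I : Type v) (A : I → Type u) [∀ i, BooleanAlgebra (A i)]
      (F : Type t) [BooleanAlgebra F] (e : ∀ i, BoundedLatticeHom (A i) F),
      IsFreeProduct.{u, v, w, t} e →
      (∀ H : ∀ i, Set (A i), (∀ i, IsNFreeOver.{u, w} (A i) n (H i)) →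
        IsNFreeOver.{t, w} F n (⋃ i, e i '' H i)) ∧
      ((∀ i, IsNFree.{u, w} (A i) n) → IsNFree.{t, w} F n)) ∧
    -- products of graph spaces
    (∀ (I : Type v) (X : I → Type u) [∀ i, TopologicalSpace (X i)],
      (∀ i, IsGraphSpace (X i)) → IsGraphSpace (∀ i, X i)) := by
  refine ⟨fun n _ A _ I C S H hA _ hS hC => hA.isNFreeOver hS hC,
    fun n _ I A _ F _ e he => ⟨fun H hA => he.isNFreeOver hA, fun hA => ?_⟩, fun I X _ hX => ?_⟩
  · choose H hH using hA
    exact ⟨_, he.isNFreeOver hH⟩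
  · choose V G hG using hX
    exact ⟨_, _, ⟨(Homeomorph.piCongrRight fun i => (hG i).some).trans
      (SimpleGraph.piCliqueSpaceHomeomorph G)⟩⟩
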